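/- Let $D$ be a link diagram on the sphere $S^2$ with finitely many crossings. For an integer $k\ge 0$, $D$ is called $k$-almost alternating if there is a set of $k$ crossings, and no set of fewer crossings, such that switching all the crossings of the set turns $D$ into an alternating diagram; a set of $k$ crossings with this property is called a set of dealternators of $D$. Given a set $K$ of dealternators, $D$ is called dealternator connected if each of the $2^k$ diagrams obtained by smoothing all the crossings of $K$, in every possible way, is connected (for $k=0$: if $D$ itself is connected). Let $s_AD$ and $s_BD$ be the families of disjoint circles obtained from $D$ by $A$-smoothing, respectively $B$-smoothing, all its crossings. The Turaev surface of $D$ is the closed surface obtained from the cobordism between $s_AD$ and $s_BD$ that has one saddle at each crossing of $D$ and is a product band over the rest of $D$, by gluing a disc along each circle of $s_AD$ and of $s_BD$. Theorem. If $D$ is a $k$-almost alternating diagram which is dealternator connected with respect to a set $K$ of dealternators, then the Turaev surface of $D$ is a closed connected orientable surface of genus exactly $k$; that is, the Turaev genus of $D$ equals $k$. -/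

import Mathlib

/-! Link diagrams, dealternators and the Turaev surface.

The projection of a link diagram is a 4-valent graph on the sphere. It is encoded by its
rotation system: crossings `Fin n`; at every crossing `x` four half-edges `(x, 0), (x, 1), (x, 2),
(x, 3)` in counterclockwise order; and the involution matching the two half-edges of each edge. -/

/-- A (planar, unoriented) link diagram with `n` crossings on the sphere.
The two strands at the crossing `x` are `{(x, 0), (x, 2)}` and `{(x, 1), (x, 3)}`.
The relative position on the sphere of different connected components of the projection is not
recorded: none of the notions below depends on it. -/
structure LinkDiagram (n : ℕ) where
  /-- `edge h` is the other half of the edge containing the half-edge `h`. -/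
  edge : Fin n × ZMod 4 → Fin n × ZMod 4
  edge_edge : ∀ h, edge (edge h) = h
  edge_ne : ∀ h, edge h ≠ h
  /-- `overEven x` is `true` if the overstrand at `x` is `{(x, 0), (x, 2)}`, and `false` if it is
  `{(x, 1), (x, 3)}`. -/
  overEven : Fin n → Bool
  /-- The number of components of the projection that are circles without crossings. -/
  circles : ℕ
  /-- Planarity: `V - E + F = 2 C`, where the faces are the orbits of "go along the edge, then take
  the next half-edge clockwise", and `C` is the number of connected components of the graph.
  As no component has Euler characteristic above 2, every component lies on a sphere. -/
  planar :
    (n : ℤ) - Nat.card (Quot fun h h' : Fin n × ZMod 4 => h' = edge h)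
      + Nat.card (Quot fun h h' : Fin n × ZMod 4 => h' = ((edge h).1, (edge h).2 - 1))
    = 2 * Nat.card (Quot fun h h' : Fin n × ZMod 4 => h' = edge h ∨ h'.1 = h.1)

namespace LinkDiagram

variable {n : ℕ}

/-- The half-edge `h` belongs to the overstrand of its crossing. -/
def IsOver (D : LinkDiagram n) (h : Fin n × ZMod 4) : Prop :=
  if D.overEven h.1 then h.2 = 0 ∨ h.2 = 2 else h.2 = 1 ∨ h.2 = 3

/-- Overpasses and underpasses alternate along the link: each edge goes from an overpass to an
underpass. -/
def IsAlternating (D : LinkDiagram n) : Prop :=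
  ∀ h, D.IsOver (D.edge h) ↔ ¬ D.IsOver h

/-- The diagram obtained by switching the crossings in `K`. -/
def switch (D : LinkDiagram n) (K : Finset (Fin n)) : LinkDiagram n :=
  { D with overEven := fun x => if x ∈ K then !D.overEven x else D.overEven x }

/-- `D` is `k`-almost alternating: some set of `k` crossings, and no set of fewer crossings, has the
property that switching it makes `D` alternating. -/
def IsAlmostAlternating (D : LinkDiagram n) (k : ℕ) : Prop :=
  IsLeast {m | ∃ K : Finset (Fin n), K.card = m ∧ (D.switch K).IsAlternating} k

/-- `K` is a set of dealternators of `D`: a set of crossings, of the least possible cardinality,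
whose switching makes `D` alternating. -/
def IsDealternatorSet (D : LinkDiagram n) (K : Finset (Fin n)) : Prop :=
  (D.switch K).IsAlternating ∧ D.IsAlmostAlternating K.card

/-- Points marked on the diagram: one for each half-edge (next to its crossing), and two on each
circle without crossings. -/
abbrev Pt (D : LinkDiagram n) : Type := (Fin n × ZMod 4) ⊕ (Fin D.circles × Bool)

/-- The other end of the arc of the projection that joins `p` to another marked point without
passing through a neighbourhood of a crossing. (A circle without crossings is cut by its two marked
points into two arcs. This is the first of them.) -/
def along (D : LinkDiagram n) : D.Pt → D.Pt
  | .inl h => .inl (D.edge h)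
  | .inr (i, b) => .inr (i, !b)

/-- The other end of the arc that starts at `p` after smoothing its crossing. There are two ways
to smooth a crossing `x`: for `s x = true` the arcs join `0` to `3` and `1` to `2`, for
`s x = false` they join `0` to `1` and `2` to `3`. (On a circle without crossings this is the second
of the two arcs.) -/
def smooth (D : LinkDiagram n) (s : Fin n → Bool) : D.Pt → D.Pt
  | .inl (x, i) => .inl (x, if s x then 3 - i else 1 - i)
  | .inr (i, b) => .inr (i, !b)

/-- The state `s_A`: at each crossing, the two regions swept by the overstrand when it turns
counterclockwise are joined. -/
def stateA (D : LinkDiagram n) : Fin n → Bool := fun x => D.overEven x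

/-- The state `s_B`: at each crossing, the two other regions are joined. -/
def stateB (D : LinkDiagram n) : Fin n → Bool := fun x => !D.overEven x

/-- Two marked points are joined by an arc in the diagram obtained from `D` by smoothing the
crossings in `K` as prescribed by `s`, and keeping the others. -/
def JoinedAfter (D : LinkDiagram n) (K : Finset (Fin n)) (s : Fin n → Bool) (p q : D.Pt) : Prop :=
  q = D.along p ∨ q = D.smooth s p ∨ ∃ x ∉ K, ∃ i j : ZMod 4, p = .inl (x, i) ∧ q = .inl (x, j)

/-- Every diagram obtained by smoothing all the crossings in `K`, in every possible way, is
connected (i.e. has exactly one connected component). -/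
def IsDealternatorConnected (D : LinkDiagram n) (K : Finset (Fin n)) : Prop :=
  ∀ s : Fin n → Bool, Nat.card (Quot (D.JoinedAfter K s)) = 1

end LinkDiagram

/-- A closed surface presented by a cell decomposition: a 3-valent graph with vertices `V` whose
edges are coloured by `Fin 3`, each vertex lying on one edge of each colour (`inv c v` is the other
end of the edge of colour `c` at `v`), with one disc glued along each cycle whose edges have
alternately two given colours. -/
structure CellSurface (V : Type*) where
  inv : Fin 3 → V → V
  inv_inv : ∀ c v, inv c (inv c v) = v
  inv_ne : ∀ c v, inv c v ≠ v

namespace CellSurface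

variable {V : Type*}

/-- Vertices minus edges plus discs. The edges are counted by their colour, the discs by the colour
that is missing on their boundary. -/
noncomputable def eulerChar (S : CellSurface V) : ℤ :=
  (Nat.card V : ℤ) - ∑ c, (Nat.card (Quot fun v w => w = S.inv c v) : ℤ)
    + ∑ c, (Nat.card (Quot fun v w => ∃ d, d ≠ c ∧ w = S.inv d v) : ℤ)

/-- The surface has exactly one connected component. -/
def IsConnected (S : CellSurface V) : Prop :=
  Nat.card (Quot fun v w => ∃ d, w = S.inv d v) = 1

/-- Orientability. An orientation of the surface orders the three colours cyclically at each vertex.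
Since each disc is bounded by edges of alternately two colours, the orders at adjacent vertices
are opposite, and conversely any such choice gives an orientation. -/
def IsOrientable (S : CellSurface V) : Prop :=
  ∃ o : V → Bool, ∀ c v, o (S.inv c v) = !o v

/-- The surface is the closed connected orientable surface of genus `g`. -/
def HasGenus (S : CellSurface V) (g : ℕ) : Prop :=
  S.IsConnected ∧ S.IsOrientable ∧ S.eulerChar = 2 - 2 * (g : ℤ)

end CellSurface

namespace LinkDiagram

variable {n : ℕ}

/-- The Turaev surface of `D`: the cobordism between the circles of `s_A D` and those of `s_B D`
which has a saddle at each crossing and is a band `[0, 1] × arc` over the rest of the projection,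
closed up by a disc along each circle of `s_A D` and of `s_B D`.

Its vertices are the two copies `(p, true)`, in `s_A D`, and `(p, false)`, in `s_B D`, of each
marked point `p`. Colour `0` is the vertical segment joining them. Colour `1` is the arc at `p` of
the smoothed crossing and colour `2` the arc along the rest of the projection. Hence the discs with
boundary coloured `0, 1` are the saddles (octagons), those coloured `0, 2` the bands over the edges,
and those coloured `1, 2` the discs along the state circles.
(A circle without crossings gives a sphere: an annulus, made of two bands, and two discs.) -/
def turaevSurface (D : LinkDiagram n) : CellSurface (D.Pt × Bool) where
  inv c v :=
    match c with
    | 0 => (v.1, !v.2)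
    | 1 => (D.smooth (if v.2 then D.stateA else D.stateB) v.1, v.2)
    | 2 => (D.along v.1, v.2)
  inv_inv c v := by
    obtain ⟨p, b⟩ := v
    fin_cases c
    · simp
    · rcases p with ⟨x, i⟩ | ⟨i, e⟩
      · cases b <;> cases h : D.overEven x <;> simp [smooth, stateA, stateB, h]
      · simp [smooth]
    · rcases p with h | ⟨i, e⟩
      · simp [along, D.edge_edge]
      · simp [along]
  inv_ne c v := by
    have h3 : ∀ i : ZMod 4, 3 - i ≠ i := by decide
    have h1 : ∀ i : ZMod 4, 1 - i ≠ i := by decide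
    obtain ⟨p, b⟩ := v
    fin_cases c
    · simp
    · rcases p with ⟨x, i⟩ | ⟨i, e⟩
      · cases b <;> cases h : D.overEven x <;> simp [smooth, stateA, stateB, h, h1, h3]
      · simp [smooth]
    · rcases p with h | ⟨i, e⟩
      · simp [along, D.edge_ne]
      · simp [along]

end LinkDiagram

/-! Write |t| for the number of circles of a state t. Counting cells gives χ = |s_A D| + |s_B D| − n
(`eulerChar_turaevSurface`), so the genus is a matter of counting circles. Let E be D with K
switched. As E is alternating, its state circles bound the faces of the projection, and Euler's
formula gives |s_A E| + |s_B E| = n + 2C, with C the number of components.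

For a state s, let s' be s reversed outside K, and C_K the number of components after smoothing K by
s. The integer δ(K) = n − |K| + 2C_K − |s| − |s'| is the Euler genus of the surface built from s and
s' after smoothing K. It does not grow when a crossing joins K (`numCircles_add_numComponents_le`).
For s = s_A E or s_B E it vanishes at ∅ by Euler's formula, and at the set of all crossings because
there s' = s; hence it vanishes throughout. For these two s, s' is s_B D, respectively s_A D.
Dealternator connectedness gives C_K = C = 1, so |s_A E| + |s_B D| + k = n + 2 = |s_B E| + |s_A D| +
k. Adding these and removing |s_A E| + |s_B E| = n + 2 leaves χ = 2 − 2k. -/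

section QuotientCounting

/-! ### Counting classes of quotients -/

variable {α β : Type*}

theorem card_quot_eq_of_map {r : α → α → Prop} (g : α → β) (hg : Function.Surjective g)
    (h₁ : ∀ a b, r a b → g a = g b) (h₂ : ∀ a b, g a = g b → Quot.mk r a = Quot.mk r b) :
    Nat.card (Quot r) = Nat.card β := by
  refine Nat.card_eq_of_bijective (Quot.lift g h₁) ⟨?_, fun b => ?_⟩
  · rintro ⟨a⟩ ⟨b⟩ h
    exact h₂ a b h
  · obtain ⟨a, rfl⟩ := hg b
    exact ⟨Quot.mk r a, rfl⟩

theorem quot_mk_eq_of_refines {r r' : α → α → Prop}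
    (h : ∀ a b, r a b → Quot.mk r' a = Quot.mk r' b) {a b : α}
    (hab : Quot.mk r a = Quot.mk r b) : Quot.mk r' a = Quot.mk r' b :=
  congrArg (Quot.lift (Quot.mk r') h) hab

theorem Finset.even_card_of_involution [DecidableEq α] (S : Finset α) (f : α → α)
    (hf : ∀ a ∈ S, f a ∈ S) (hff : ∀ a, f (f a) = a) (hne : ∀ a, f a ≠ a) : Even S.card := by
  have h : ∑ a ∈ S, (1 : ZMod 2) = 0 :=
    Finset.sum_involution (fun a _ => f a) (fun _ _ => by decide) (fun a _ _ => hne a)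
      (fun a ha => hf a ha) (fun a _ => hff a)
  rw [← ZMod.natCast_eq_zero_iff_even]
  simpa using h

variable [Finite α]

theorem card_quot_le_of_refines {r r' : α → α → Prop}
    (h : ∀ a b, r a b → Quot.mk r' a = Quot.mk r' b) :
    Nat.card (Quot r') ≤ Nat.card (Quot r) := by
  refine Nat.card_le_card_of_surjective (Quot.lift (Quot.mk r') h) ?_
  rintro ⟨a⟩
  exact ⟨Quot.mk r a, rfl⟩

theorem card_quot_lt_of_refines {r r' : α → α → Prop}
    (h : ∀ a b, r a b → Quot.mk r' a = Quot.mk r' b) {x y : α}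
    (hxy : Quot.mk r x ≠ Quot.mk r y) (hxy' : Quot.mk r' x = Quot.mk r' y) :
    Nat.card (Quot r') < Nat.card (Quot r) := by
  have hs : Function.Surjective (Quot.lift (Quot.mk r') h) := by
    rintro ⟨a⟩
    exact ⟨Quot.mk r a, rfl⟩
  refine lt_of_le_of_ne (Nat.card_le_card_of_surjective _ hs) fun hc => hxy ?_
  exact ((Nat.bijective_iff_surjective_and_card _).2 ⟨hs, hc.symm⟩).1 hxy'

/-- Identifying two classes lowers the number of classes by at most one. -/
theorem card_quot_le_add_one {r r' : α → α → Prop} (x y : α)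
    (h : ∀ a b, r' a b → Quot.mk r a = Quot.mk r b ∨
      (Quot.mk r a = Quot.mk r x ∨ Quot.mk r a = Quot.mk r y) ∧
      (Quot.mk r b = Quot.mk r x ∨ Quot.mk r b = Quot.mk r y)) :
    Nat.card (Quot r) ≤ Nat.card (Quot r') + 1 := by
  classical
  let g : Quot r → Quot r := fun c => if c = Quot.mk r y then Quot.mk r x else c
  have hg : ∀ a b, r' a b → g (Quot.mk r a) = g (Quot.mk r b) := by
    intro a b hab
    rcases h a b hab with h | ⟨h | h, h' | h'⟩ <;> simp only [g] <;> rw [h] <;> (try rw [h']) <;>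
      simp
  -- `none` covers the class of `y`, the only one that `g` can miss.
  let G : Option (Quot r') → Quot r := fun c =>
    c.elim (Quot.mk r y) (Quot.lift (fun a => g (Quot.mk r a)) hg)
  have hG : Function.Surjective G := by
    rintro ⟨a⟩
    by_cases ha : Quot.mk r a = Quot.mk r y
    · exact ⟨none, ha.symm⟩
    · exact ⟨some (Quot.mk r' a), if_neg ha⟩
  simpa [Finite.card_option] using Nat.card_le_card_of_surjective G hG

theorem card_quot_involution (f : α → α) (hff : ∀ a, f (f a) = a) (hne : ∀ a, f a ≠ a) :
    2 * Nat.card (Quot fun a b => b = f a) = Nat.card α := by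
  classical
  cases nonempty_fintype α
  have : Fintype (Quot fun a b => b = f a) := Fintype.ofFinite _
  have hmk : ∀ a b, Quot.mk (fun a b => b = f a) a = Quot.mk (fun a b => b = f a) b →
      a = b ∨ a = f b := by
    intro a b h
    replace h := Quot.eqvGen_exact h
    induction h with
    | rel a b h => exact .inr (by rw [h, hff])
    | refl a => exact .inl rfl
    | symm a b _ ih =>
      rcases ih with rfl | rfl
      · exact .inl rfl
      · exact .inr (hff b).symm
    | trans a b c _ _ ih ih' =>
      rcases ih with rfl | rfl <;> rcases ih' with rfl | rfl <;> simp [hff]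
  rw [Nat.card_eq_fintype_card, Nat.card_eq_fintype_card, ← Finset.card_univ (α := α),
    Finset.card_eq_sum_card_fiberwise (f := Quot.mk fun a b => b = f a)
      (t := Finset.univ) (by simp)]
  rw [Finset.sum_congr rfl (g := fun _ => 2)]
  · simp [mul_comm]
  · rintro ⟨a⟩ -
    have : ({b | Quot.mk (fun a b => b = f a) b = Quot.mk _ a} : Finset α) = {a, f a} := by
      ext b
      simp only [Finset.mem_filter, Finset.mem_univ, true_and, Finset.mem_insert,
        Finset.mem_singleton]
      refine ⟨hmk b a, ?_⟩
      rintro (rfl | rfl)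
      · rfl
      · exact (Quot.sound (r := fun a b => b = f a) rfl).symm
    exact (congrArg Finset.card this).trans (Finset.card_pair (hne a).symm)

end QuotientCounting

namespace LinkDiagram

variable {n : ℕ}

/-! ### Smoothings, state circles and components -/

theorem along_along (D : LinkDiagram n) (p : D.Pt) : D.along (D.along p) = p := by
  rcases p with h | ⟨i, b⟩ <;> simp [along, D.edge_edge]

theorem along_switch (D : LinkDiagram n) (K : Finset (Fin n)) (p : D.Pt) :
    (D.switch K).along p = D.along p := by
  rcases p with h | ⟨i, b⟩ <;> rfl

theorem smooth_switch (D : LinkDiagram n) (K : Finset (Fin n)) (s : Fin n → Bool) (p : D.Pt) :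
    (D.switch K).smooth s p = D.smooth s p := by
  rcases p with ⟨x, i⟩ | ⟨i, b⟩ <;> rfl

theorem along_ne (D : LinkDiagram n) (p : D.Pt) : D.along p ≠ p := by
  rcases p with h | ⟨i, b⟩ <;> simp [along, D.edge_ne]

theorem smooth_smooth (D : LinkDiagram n) (s : Fin n → Bool) (p : D.Pt) :
    D.smooth s (D.smooth s p) = p := by
  rcases p with ⟨x, i⟩ | ⟨i, b⟩
  · cases h : s x <;> simp [smooth, h]
  · simp [smooth]

theorem smooth_ne (D : LinkDiagram n) (s : Fin n → Bool) (p : D.Pt) : D.smooth s p ≠ p := by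
  have h3 : ∀ i : ZMod 4, 3 - i ≠ i := by decide
  have h1 : ∀ i : ZMod 4, 1 - i ≠ i := by decide
  rcases p with ⟨x, i⟩ | ⟨i, b⟩
  · cases h : s x <;> simp [smooth, h, h1, h3]
  · simp [smooth]

theorem smooth_congr (D : LinkDiagram n) {s t : Fin n → Bool} {x : Fin n}
    (h : ∀ y, y ≠ x → s y = t y) {p : D.Pt} (hp : ∀ i, p ≠ .inl (x, i)) :
    D.smooth s p = D.smooth t p := by
  rcases p with ⟨y, i⟩ | ⟨i, b⟩
  · have hy : y ≠ x := fun hy => hp i (by rw [hy])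
    simp [smooth, h y hy]
  · rfl

/-- Two marked points are joined by an arc in the state `s`. -/
def JoinedInState (D : LinkDiagram n) (s : Fin n → Bool) (p q : D.Pt) : Prop :=
  q = D.along p ∨ q = D.smooth s p

/-- The number of circles of the state `s`. -/
noncomputable def numCircles (D : LinkDiagram n) (s : Fin n → Bool) : ℕ :=
  Nat.card (Quot (D.JoinedInState s))

/-- The number of connected components after smoothing the crossings in `K`. -/
noncomputable def numComponents (D : LinkDiagram n) (K : Finset (Fin n)) (s : Fin n → Bool) : ℕ :=
  Nat.card (Quot (D.JoinedAfter K s))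

theorem numCircles_switch (D : LinkDiagram n) (K : Finset (Fin n)) (s : Fin n → Bool) :
    (D.switch K).numCircles s = D.numCircles s := by
  have : (D.switch K).JoinedInState s = D.JoinedInState s := by
    funext p q
    exact congrArg₂ (fun a b => q = a ∨ q = b) (D.along_switch K p) (D.smooth_switch K s p)
  exact congrArg (fun r : D.Pt → D.Pt → Prop => Nat.card (Quot r)) this

theorem numComponents_switch (D : LinkDiagram n) (K L : Finset (Fin n)) (s : Fin n → Bool) :
    (D.switch K).numComponents L s = D.numComponents L s := by
  have : (D.switch K).JoinedAfter L s = D.JoinedAfter L s := by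
    funext p q
    exact congrArg₂ (fun a b => q = a ∨ q = b ∨
        ∃ x ∉ L, ∃ i j : ZMod 4, p = .inl (x, i) ∧ q = .inl (x, j))
      (D.along_switch K p) (D.smooth_switch K s p)
  exact congrArg (fun r : D.Pt → D.Pt → Prop => Nat.card (Quot r)) this

/-- The state that agrees with `s` exactly at the crossings in `K`. -/
def flipOutside (s : Fin n → Bool) (K : Finset (Fin n)) : Fin n → Bool :=
  fun x => if x ∈ K then s x else !s x

/-! ### Changing a state at one crossing -/

/-- If a relation contains a smoothing at `x`, every point at `x` is related to `(x, 0)` or to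
`(x, 2)`. -/
theorem mk_eq_zero_or_two (D : LinkDiagram n) {r : D.Pt → D.Pt → Prop} {s : Fin n → Bool}
    {x : Fin n}
    (h : ∀ i, Quot.mk r (.inl (x, i)) = Quot.mk r (D.smooth s (.inl (x, i)))) (i : ZMod 4) :
    Quot.mk r (.inl (x, i)) = Quot.mk r (.inl (x, 0)) ∨
      Quot.mk r (.inl (x, i)) = Quot.mk r (.inl (x, 2)) := by
  -- In either smoothing `0` and `2` lie on different arcs, and an odd end is the partner of one of
  -- them.
  have h13 : ∀ j : ZMod 4, j = 0 ∨ j = 2 ∨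
      ((3 - j = 0 ∨ 3 - j = 2) ∧ (1 - j = 0 ∨ 1 - j = 2)) := by decide
  rcases h13 i with rfl | rfl | ⟨h3, h1⟩
  · exact .inl rfl
  · exact .inr rfl
  · rw [h i]
    cases hs : s x
    · rcases h1 with h1 | h1 <;> simp [smooth, hs, h1]
    · rcases h3 with h1 | h1 <;> simp [smooth, hs, h1]

theorem mk_eq_mk_of_zero_two (D : LinkDiagram n) {r : D.Pt → D.Pt → Prop} {s : Fin n → Bool}
    {x : Fin n}
    (h : ∀ i, Quot.mk r (.inl (x, i)) = Quot.mk r (D.smooth s (.inl (x, i))))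
    (h02 : Quot.mk r (.inl (x, 0)) = Quot.mk r (.inl (x, 2))) (i j : ZMod 4) :
    Quot.mk r (.inl (x, i)) = Quot.mk r (.inl (x, j)) := by
  have hk : ∀ k, Quot.mk r (.inl (x, k)) = Quot.mk r (.inl (x, 0)) := fun k =>
    (D.mk_eq_zero_or_two h k).elim id fun hk => hk.trans h02.symm
  rw [hk, hk j]

/-- If the two arcs of the state `t` at `x` lie on different circles, then removing one of them
does not separate its ends. -/
theorem mk_eq_mk_of_ne (D : LinkDiagram n) {t : Fin n → Bool} {x : Fin n}
    (hne : Quot.mk (D.JoinedInState t) (.inl (x, 0)) ≠ Quot.mk (D.JoinedInState t) (.inl (x, 2)))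
    {r : D.Pt → D.Pt → Prop} (hr₁ : ∀ p, Quot.mk r p = Quot.mk r (D.along p))
    (hr₂ : ∀ p, (∀ i, p ≠ .inl (x, i)) → Quot.mk r p = Quot.mk r (D.smooth t p)) (i : ZMod 4) :
    Quot.mk r (.inl (x, i)) = Quot.mk r (D.smooth t (.inl (x, i))) := by
  classical
  -- The state `t` with both arcs at `x` removed.
  let r₀ : D.Pt → D.Pt → Prop := fun p q =>
    q = D.along p ∨ (∀ i, p ≠ .inl (x, i)) ∧ q = D.smooth t p
  have h₀ : ∀ p q, r₀ p q → Quot.mk r p = Quot.mk r q := by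
    rintro p q (rfl | ⟨hp, rfl⟩)
    · exact hr₁ p
    · exact hr₂ p hp
  have ht : ∀ p q, r₀ p q → Quot.mk (D.JoinedInState t) p = Quot.mk (D.JoinedInState t) q := by
    rintro p q (rfl | ⟨hp, rfl⟩)
    · exact Quot.sound (.inl rfl)
    · exact Quot.sound (.inr rfl)
  refine quot_mk_eq_of_refines h₀ ?_
  by_contra hcon
  -- Only one endpoint at `x` lies in the component of `(x, i)`.
  have hother : ∀ j, Quot.mk r₀ (.inl (x, j)) = Quot.mk r₀ (.inl (x, i)) → j = i := by
    intro j hj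
    by_contra hji
    have hj' := quot_mk_eq_of_refines ht hj
    have hsm : ∀ j, Quot.mk (D.JoinedInState t) (.inl (x, j)) =
      Quot.mk (D.JoinedInState t) (D.smooth t (.inl (x, j))) := fun j => Quot.sound (.inr rfl)
    -- Two distinct ends at `x` bound the same arc, or lie one on the arc of `0` and one on the arc
    -- of `2`; `hne` excludes the latter.
    have key : ∀ a b : ZMod 4, a ≠ b →
        (a = 3 - b ∨ (a = 0 ∨ 3 - a = 0) ∧ (b = 2 ∨ 3 - b = 2) ∨
          (a = 2 ∨ 3 - a = 2) ∧ (b = 0 ∨ 3 - b = 0)) ∧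
        (a = 1 - b ∨ (a = 0 ∨ 1 - a = 0) ∧ (b = 2 ∨ 1 - b = 2) ∨
          (a = 2 ∨ 1 - a = 2) ∧ (b = 0 ∨ 1 - b = 0)) := by decide
    have hrep : ∀ a c : ZMod 4, (a = c ∨ (if t x then 3 - a else 1 - a) = c) →
        Quot.mk (D.JoinedInState t) (.inl (x, a)) = Quot.mk (D.JoinedInState t) (.inl (x, c)) := by
      rintro a c (rfl | rfl)
      · rfl
      · exact hsm a
    have key' : j = (if t x then 3 - i else 1 - i) ∨
        (j = 0 ∨ (if t x then 3 - j else 1 - j) = 0) ∧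
          (i = 2 ∨ (if t x then 3 - i else 1 - i) = 2) ∨
        (j = 2 ∨ (if t x then 3 - j else 1 - j) = 2) ∧
          (i = 0 ∨ (if t x then 3 - i else 1 - i) = 0) := by
      cases htx : t x
      · simpa using (key j i hji).2
      · simpa using (key j i hji).1
    rcases key' with h | ⟨h, h'⟩ | ⟨h, h'⟩
    · exact hcon (by rw [← hj, h]; rfl)
    · exact hne ((hrep j 0 h).symm.trans (hj'.trans (hrep i 2 h')))
    · exact hne ((hrep i 0 h').symm.trans (hj'.symm.trans (hrep j 2 h)))
  let S : Finset D.Pt := {q | Quot.mk r₀ q = Quot.mk r₀ (.inl (x, i))}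
  have hS : ∀ q, q ∈ S ↔ Quot.mk r₀ q = Quot.mk r₀ (.inl (x, i)) := fun q => by simp [S]
  -- Parity: `along` pairs off the whole class, `D.smooth t` pairs off all of it but `(x, i)`.
  have e₁ : Even S.card := S.even_card_of_involution D.along
    (fun q hq => (hS _).2 ((Quot.sound (.inl rfl)).symm.trans ((hS q).1 hq)))
    D.along_along D.along_ne
  have e₂ : Even (S.erase (.inl (x, i))).card := by
    refine Finset.even_card_of_involution _ (D.smooth t) (fun q hq => ?_)
      (D.smooth_smooth t) (D.smooth_ne t)
    obtain ⟨hqi, hqS⟩ := Finset.mem_erase.1 hq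
    have hqx : ∀ j, q ≠ .inl (x, j) := by
      rintro j rfl
      exact hqi (by rw [hother j ((hS _).1 hqS)])
    refine Finset.mem_erase.2 ⟨fun h => ?_, ?_⟩
    · refine hqx (if t x then 3 - i else 1 - i) ?_
      rw [← D.smooth_smooth t q, h]
      rfl
    · exact (hS _).2 ((Quot.sound (.inr ⟨hqx, rfl⟩)).symm.trans ((hS q).1 hqS))
  have hmem : (.inl (x, i) : D.Pt) ∈ S := (hS _).2 rfl
  rw [← Finset.card_erase_add_one hmem] at e₁
  exact (Nat.not_even_iff_odd.2 e₂.add_one) e₁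

/-- The circle count changes by at most one if a state is changed at one crossing. -/
theorem numCircles_le_add_one (D : LinkDiagram n) {s t : Fin n → Bool} {x : Fin n}
    (h : ∀ y, y ≠ x → s y = t y) : D.numCircles s ≤ D.numCircles t + 1 := by
  -- Linking the two arcs of `s` at `x` identifies all four ends there, so `r` also contains the
  -- arcs of `t`.
  let r : D.Pt → D.Pt → Prop := fun p q =>
    D.JoinedInState s p q ∨ p = .inl (x, 0) ∧ q = .inl (x, 2)
  have hle : Nat.card (Quot r) ≤ D.numCircles t := by
    refine card_quot_le_of_refines ?_
    rintro p q (rfl | rfl)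
    · exact Quot.sound (.inl (.inl rfl))
    · by_cases hp : ∀ i, p ≠ .inl (x, i)
      · rw [← D.smooth_congr h hp]
        exact Quot.sound (.inl (.inr rfl))
      · push Not at hp
        obtain ⟨i, rfl⟩ := hp
        exact D.mk_eq_mk_of_zero_two (s := s) (fun i => Quot.sound (.inl (.inr rfl)))
          (Quot.sound (.inr ⟨rfl, rfl⟩)) _ _
  refine (card_quot_le_add_one (r' := r) (.inl (x, 0)) (.inl (x, 2)) ?_).trans
    (Nat.add_le_add_right hle 1)
  rintro p q (h | ⟨rfl, rfl⟩)
  · exact .inl (Quot.sound h)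
  · exact .inr ⟨.inl rfl, .inr rfl⟩

/-- Changing a state at a crossing whose arcs lie on different circles merges the two circles. -/
theorem numCircles_lt (D : LinkDiagram n) {s t : Fin n → Bool} {x : Fin n}
    (h : ∀ y, y ≠ x → s y = t y) (hx : s x = !t x)
    (hne : Quot.mk (D.JoinedInState t) (.inl (x, 0)) ≠ Quot.mk (D.JoinedInState t) (.inl (x, 2))) :
    D.numCircles s < D.numCircles t := by
  have h₁ : ∀ i, Quot.mk (D.JoinedInState s) (.inl (x, i)) =
      Quot.mk (D.JoinedInState s) (D.smooth t (.inl (x, i))) :=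
    D.mk_eq_mk_of_ne hne (fun p => Quot.sound (.inl rfl))
      (fun p hp => by rw [← D.smooth_congr h hp]; exact Quot.sound (.inr rfl))
  have h₂ : ∀ i, Quot.mk (D.JoinedInState s) (.inl (x, i)) =
      Quot.mk (D.JoinedInState s) (D.smooth s (.inl (x, i))) := fun i => Quot.sound (.inr rfl)
  refine card_quot_lt_of_refines ?_ hne ?_
  · rintro p q (rfl | rfl)
    · exact Quot.sound (.inl rfl)
    · by_cases hp : ∀ i, p ≠ .inl (x, i)
      · rw [← D.smooth_congr h hp]
        exact Quot.sound (.inr rfl)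
      · push Not at hp
        obtain ⟨i, rfl⟩ := hp
        exact h₁ i
  -- The partner of `0` in `t` is the partner of `2` in `s`.
  · have a := h₁ 0
    have b := h₂ 0
    have c := h₁ 2
    have d := h₂ 2
    have e₁ : (3 - 2 : ZMod 4) = 1 := by decide
    have e₂ : (1 - 2 : ZMod 4) = 3 := by decide
    cases ht : t x <;> simp only [smooth, hx, ht, e₁, e₂, Bool.not_true, Bool.not_false, if_true,
      if_false, sub_zero, Bool.false_eq_true] at a b c d
    · exact a.trans d.symm
    · exact a.trans d.symm

/-! ### Smoothing a set of crossings -/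

/-- If the two arcs at `x` stay in one component, no component is gained and the circle count
changes by at most one. Otherwise at most one component is gained; but each circle stays within a
component, so the arcs lie on different circles, and the change at `x` merges these. That strict
drop pays for the new component. -/
theorem numCircles_add_numComponents_le (D : LinkDiagram n) (s : Fin n → Bool)
    {K : Finset (Fin n)} {x : Fin n} (hx : x ∉ K) :
    D.numCircles (flipOutside s K) + 2 * D.numComponents (insert x K) s ≤
      D.numCircles (flipOutside s (insert x K)) + 1 + 2 * D.numComponents K s := by
  have hflip : ∀ y, y ≠ x → flipOutside s K y = flipOutside s (insert x K) y := by
    intro y hy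
    simp [flipOutside, hy]
  have hsm : ∀ i, Quot.mk (D.JoinedAfter (insert x K) s) (.inl (x, i)) =
      Quot.mk (D.JoinedAfter (insert x K) s) (D.smooth s (.inl (x, i))) :=
    fun i => Quot.sound (.inr (.inl rfl))
  by_cases h02 : Quot.mk (D.JoinedAfter (insert x K) s) (.inl (x, 0)) =
      Quot.mk (D.JoinedAfter (insert x K) s) (.inl (x, 2))
  · have h₁ := D.numCircles_le_add_one hflip
    have h₂ : D.numComponents (insert x K) s ≤ D.numComponents K s := by
      refine card_quot_le_of_refines ?_
      rintro p q (rfl | rfl | ⟨y, hy, i, j, rfl, rfl⟩)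
      · exact Quot.sound (.inl rfl)
      · exact Quot.sound (.inr (.inl rfl))
      · by_cases hyx : y = x
        · subst hyx
          exact D.mk_eq_mk_of_zero_two hsm h02 i j
        · exact Quot.sound (.inr (.inr ⟨y, by simp [hyx, hy], i, j, rfl, rfl⟩))
    omega
  · have h₁ : D.numComponents (insert x K) s ≤ D.numComponents K s + 1 := by
      refine card_quot_le_add_one (.inl (x, 0)) (.inl (x, 2)) ?_
      rintro p q (rfl | rfl | ⟨y, hy, i, j, rfl, rfl⟩)
      · exact .inl (Quot.sound (.inl rfl))
      · exact .inl (Quot.sound (.inr (.inl rfl)))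
      · by_cases hyx : y = x
        · subst hyx
          exact .inr ⟨D.mk_eq_zero_or_two hsm i, D.mk_eq_zero_or_two hsm j⟩
        · exact .inl (Quot.sound (.inr (.inr ⟨y, by simp [hyx, hy], i, j, rfl, rfl⟩)))
    have h₂ : D.numCircles (flipOutside s K) < D.numCircles (flipOutside s (insert x K)) := by
      refine D.numCircles_lt hflip (by simp [flipOutside, hx]) fun h => h02 ?_
      refine quot_mk_eq_of_refines ?_ h
      rintro p q (rfl | rfl)
      · exact Quot.sound (.inl rfl)
      · rcases p with ⟨y, i⟩ | ⟨i, b⟩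
        · by_cases hy : y ∈ insert x K
          · refine Quot.sound (.inr (.inl ?_))
            simp only [smooth, flipOutside, if_pos hy]
          · exact Quot.sound (.inr (.inr ⟨y, hy, i, _, rfl, rfl⟩))
        · exact Quot.sound (.inr (.inl rfl))
    omega

theorem numCircles_add_numComponents_mono (D : LinkDiagram n) (s : Fin n → Bool)
    (K L : Finset (Fin n)) (hL : Disjoint K L) :
    D.numCircles (flipOutside s K) + 2 * D.numComponents (K ∪ L) s ≤
      D.numCircles (flipOutside s (K ∪ L)) + L.card + 2 * D.numComponents K s := by
  induction L using Finset.induction_on with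
  | empty => simp
  | insert x L hx ih =>
    rw [Finset.disjoint_insert_right] at hL
    have h₁ := ih hL.2
    have h₂ := D.numCircles_add_numComponents_le s (K := K ∪ L) (x := x) (by simp [hL.1, hx])
    rw [Finset.union_insert, Finset.card_insert_of_notMem hx]
    omega

/-- Smoothing crossings of a diagram does not make it more connected. -/
theorem numComponents_empty_eq_one (D : LinkDiagram n) {K : Finset (Fin n)} {s : Fin n → Bool}
    (h : D.numComponents K s = 1) : D.numComponents ∅ s = 1 := by
  refine le_antisymm ?_ ?_
  · rw [← h]
    refine card_quot_le_of_refines ?_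
    rintro p q (h | h | ⟨x, -, h⟩)
    · exact Quot.sound (.inl h)
    · exact Quot.sound (.inr (.inl h))
    · exact Quot.sound (.inr (.inr ⟨x, Finset.notMem_empty x, h⟩))
  · obtain ⟨-, ⟨c⟩⟩ := Nat.card_eq_one_iff_unique.1 h
    obtain ⟨p, -⟩ := Quot.exists_rep c
    have : Nonempty (Quot (D.JoinedAfter ∅ s)) := ⟨Quot.mk _ p⟩
    exact Nat.card_pos

theorem numComponents_univ (D : LinkDiagram n) (s : Fin n → Bool) :
    D.numComponents Finset.univ s = D.numCircles s := by
  have : D.JoinedAfter Finset.univ s = D.JoinedInState s := by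
    ext p q
    simp [JoinedAfter, JoinedInState]
  rw [numComponents, this, numCircles]

/-- If the sphere count `|s| + |s̄| = n + 2 C` holds for a state and its opposite, then it holds
after smoothing any set of crossings according to the state. -/
theorem numCircles_add_numCircles_of_planar (D : LinkDiagram n) (s : Fin n → Bool)
    (K : Finset (Fin n))
    (h : D.numCircles s + D.numCircles (fun x => !s x) = n + 2 * D.numComponents ∅ s) :
    D.numCircles s + D.numCircles (flipOutside s K) + K.card = n + 2 * D.numComponents K s := by
  -- The inequalities from ∅ to `K` and from `K` to all crossings add up to an equality by `h`, so
  -- both are sharp.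
  have h₁ := D.numCircles_add_numComponents_mono s ∅ K (by simp)
  have h₂ := D.numCircles_add_numComponents_mono s K Kᶜ disjoint_compl_right
  have e₁ : flipOutside s ∅ = fun x => !s x := by ext; simp [flipOutside]
  have e₂ : flipOutside s Finset.univ = s := by ext; simp [flipOutside]
  rw [Finset.empty_union, e₁] at h₁
  rw [Finset.union_compl, e₂, numComponents_univ, Finset.card_compl, Fintype.card_fin] at h₂
  have hK : K.card ≤ n := by simpa using K.card_le_univ
  omega

/-! ### Faces of an alternating diagram and Euler's formula -/

theorem numComponents_empty (D : LinkDiagram n) (s : Fin n → Bool) :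
    D.numComponents ∅ s =
      Nat.card (Quot fun h h' : Fin n × ZMod 4 => h' = D.edge h ∨ h'.1 = h.1) + D.circles := by
  let r : Fin n × ZMod 4 → Fin n × ZMod 4 → Prop := fun h h' => h' = D.edge h ∨ h'.1 = h.1
  let g : D.Pt → Quot r ⊕ Fin D.circles := Sum.map (Quot.mk r) Prod.fst
  have hg : Function.Surjective g :=
    (Quot.mk_surjective).sumMap fun i => ⟨(i, true), rfl⟩
  rw [numComponents, card_quot_eq_of_map g hg, Nat.card_sum, Nat.card_fin]
  · rintro p q (rfl | rfl | ⟨y, -, i, j, rfl, rfl⟩)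
    · rcases p with h | ⟨i, b⟩
      · exact congrArg Sum.inl (Quot.sound (.inl rfl))
      · rfl
    · rcases p with h | ⟨i, b⟩
      · exact congrArg Sum.inl (Quot.sound (.inr rfl))
      · rfl
    · exact congrArg Sum.inl (Quot.sound (.inr rfl))
  · rintro (h | ⟨i, b⟩) (h' | ⟨j, b'⟩) hh
    · have hh : Quot.mk r h = Quot.mk r h' := Sum.inl_injective hh
      refine congrArg (Quot.map (Sum.inl : _ → D.Pt) ?_) hh
      rintro a ⟨y, i⟩ (h | h)
      · exact .inl (congrArg Sum.inl h)
      · exact .inr (.inr ⟨a.1, by simp, a.2, i, rfl, by rw [← h]⟩)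
    · cases hh
    · cases hh
    · obtain rfl : i = j := Sum.inr_injective hh
      by_cases hb : b' = b
      · rw [hb]
      · refine Quot.sound (.inl ?_)
        cases b <;> cases b' <;> simp_all [along]

/-- The over/under pattern, extended to the circles without crossings. -/
def IsOverPt (D : LinkDiagram n) : D.Pt → Prop
  | .inl h => D.IsOver h
  | .inr (_, b) => b = true

theorem isOver_sub (D : LinkDiagram n) (x : Fin n) (i : ZMod 4) :
    (D.IsOver (x, 1 - i) ↔ ¬ D.IsOver (x, i)) ∧
      (D.IsOver (x, 3 - i) ↔ ¬ D.IsOver (x, i)) := by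
  have key : ∀ (o : Bool) (i : ZMod 4), let P := fun i : ZMod 4 =>
      if o then i = 0 ∨ i = 2 else i = 1 ∨ i = 3
      (P (1 - i) ↔ ¬ P i) ∧ (P (3 - i) ↔ ¬ P i) := by decide
  exact key (D.overEven x) i

theorem isOverPt_smooth (D : LinkDiagram n) (s : Fin n → Bool) (p : D.Pt) :
    D.IsOverPt (D.smooth s p) ↔ ¬ D.IsOverPt p := by
  rcases p with ⟨x, i⟩ | ⟨i, b⟩
  · cases h : s x <;> simp [smooth, h, IsOverPt, D.isOver_sub]
  · cases b <;> simp [smooth, IsOverPt]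

theorem IsAlternating.isOverPt_along {D : LinkDiagram n} (hD : D.IsAlternating) (p : D.Pt) :
    D.IsOverPt (D.along p) ↔ ¬ D.IsOverPt p := by
  rcases p with h | ⟨i, b⟩
  · exact hD h
  · cases b <;> simp [along, IsOverPt]

/-- The face permutation, extended by the identity to the circles without crossings. -/
def nextOnFace (D : LinkDiagram n) : D.Pt → D.Pt
  | .inl h => .inl ((D.edge h).1, (D.edge h).2 - 1)
  | .inr p => .inr p

/-- The clockwise turn at the end of an edge follows an arc of one of the two smoothings; whether it
is that of `s_A` or `s_B` depends only on over or under, which alternation transfers from the start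
of the edge. -/
theorem IsAlternating.nextOnFace_eq {D : LinkDiagram n} (hD : D.IsAlternating) (p : D.Pt) :
    (D.IsOverPt p → D.nextOnFace p = D.smooth D.stateB (D.along p)) ∧
      (¬ D.IsOverPt p → D.nextOnFace p = D.smooth D.stateA (D.along p)) := by
  rcases p with h | ⟨i, b⟩
  · have hh := hD h
    have key : ∀ o : Bool, ∀ j : ZMod 4, (((if o then j = 0 ∨ j = 2 else j = 1 ∨ j = 3) →
        j - 1 = if o then 3 - j else 1 - j) ∧
        (¬ (if o then j = 0 ∨ j = 2 else j = 1 ∨ j = 3) →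
        j - 1 = if !o then 3 - j else 1 - j)) := by decide
    have key' := key (D.overEven (D.edge h).1) (D.edge h).2
    constructor
    · intro hp
      have hn : ¬ D.IsOver (D.edge h) := fun h' => hh.1 h' hp
      exact congrArg (fun j => (Sum.inl ((D.edge h).1, j) : D.Pt)) (key'.2 hn)
    · intro hp
      exact congrArg (fun j => (Sum.inl ((D.edge h).1, j) : D.Pt)) (key'.1 (hh.2 hp))
  · simp [nextOnFace, smooth, along]

theorem IsAlternating.isOverPt_nextOnFace {D : LinkDiagram n} (hD : D.IsAlternating) (p : D.Pt) :
    D.IsOverPt (D.nextOnFace p) ↔ D.IsOverPt p := by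
  by_cases hp : D.IsOverPt p
  · rw [(hD.nextOnFace_eq p).1 hp, isOverPt_smooth, hD.isOverPt_along, not_not]
  · rw [(hD.nextOnFace_eq p).2 hp, isOverPt_smooth, hD.isOverPt_along, not_not]

theorem card_quot_nextOnFace (D : LinkDiagram n) :
    Nat.card (Quot fun p q : D.Pt => q = D.nextOnFace p) =
      Nat.card (Quot fun h h' : Fin n × ZMod 4 => h' = ((D.edge h).1, (D.edge h).2 - 1)) +
        2 * D.circles := by
  let r : Fin n × ZMod 4 → Fin n × ZMod 4 → Prop := fun h h' =>
    h' = ((D.edge h).1, (D.edge h).2 - 1)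
  let g : D.Pt → Quot r ⊕ (Fin D.circles × Bool) := Sum.map (Quot.mk r) id
  have hg : Function.Surjective g := (Quot.mk_surjective).sumMap Function.surjective_id
  rw [card_quot_eq_of_map g hg, Nat.card_sum, Nat.card_prod, Nat.card_fin]
  · simp [r, mul_comm]
  · rintro p q rfl
    rcases p with h | p
    · exact congrArg Sum.inl (Quot.sound rfl)
    · rfl
  · rintro (h | p) (h' | q) hh
    · have hh : Quot.mk r h = Quot.mk r h' := Sum.inl_injective hh
      refine congrArg (Quot.map (Sum.inl : _ → D.Pt) ?_) hh
      rintro a b rfl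
      rfl
    · cases hh
    · cases hh
    · obtain rfl : p = q := Sum.inr_injective hh
      rfl

/-- In an alternating diagram the circles of `s_A` and `s_B` are the boundaries of the faces. -/
theorem IsAlternating.numCircles_add_numCircles {D : LinkDiagram n} (hD : D.IsAlternating) :
    D.numCircles D.stateA + D.numCircles D.stateB =
      Nat.card (Quot fun p q : D.Pt => q = D.nextOnFace p) := by
  classical
  let r : D.Pt → D.Pt → Prop := fun p q => q = D.nextOnFace p
  let A := D.JoinedInState D.stateA
  let B := D.JoinedInState D.stateB
  -- `nextOnFace` preserves `IsOverPt`, so a face orbit consists of over points and follows a circle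
  -- of `s_B`, or of under points and follows a circle of `s_A`.
  let g : D.Pt → Quot A ⊕ Quot B := fun p =>
    if D.IsOverPt p then .inr (Quot.mk B p) else .inl (Quot.mk A p)
  have hgo : ∀ p, D.IsOverPt p → g p = .inr (Quot.mk B p) := fun p hp => if_pos hp
  have hgu : ∀ p, ¬ D.IsOverPt p → g p = .inl (Quot.mk A p) := fun p hp => if_neg hp
  have hAa : ∀ p, Quot.mk A p = Quot.mk A (D.along p) := fun p => Quot.sound (.inl rfl)
  have hBa : ∀ p, Quot.mk B p = Quot.mk B (D.along p) := fun p => Quot.sound (.inl rfl)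
  have hAs : ∀ p, Quot.mk A p = Quot.mk A (D.smooth D.stateA p) := fun p => Quot.sound (.inr rfl)
  have hBs : ∀ p, Quot.mk B p = Quot.mk B (D.smooth D.stateB p) := fun p => Quot.sound (.inr rfl)
  -- The face next to the state circle through `p`.
  let F : Bool → D.Pt → Quot r := fun b p =>
    if (D.IsOverPt p ↔ b = true) then Quot.mk r p else Quot.mk r (D.along p)
  have hF : ∀ b, ∀ p q, D.JoinedInState (if b then D.stateB else D.stateA) p q →
      F b p = F b q := by
    have hs : ∀ b p, (D.IsOverPt p ↔ b = true) →
        Quot.mk r p =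
          Quot.mk r (D.smooth (if b then D.stateB else D.stateA) (D.along p)) := by
      intro b p hp
      refine Quot.sound ?_
      cases b
      · exact ((hD.nextOnFace_eq p).2 (by simpa using hp)).symm
      · exact ((hD.nextOnFace_eq p).1 (by simpa using hp)).symm
    rintro b p q (rfl | rfl)
    · by_cases hp : D.IsOverPt p ↔ b = true
      · have hp' : ¬ (D.IsOverPt (D.along p) ↔ b = true) := by rw [hD.isOverPt_along]; tauto
        simp only [F, if_pos hp, if_neg hp', D.along_along]
      · have hp' : D.IsOverPt (D.along p) ↔ b = true := by rw [hD.isOverPt_along]; tauto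
        simp only [F, if_neg hp, if_pos hp']
    · set t := if b then D.stateB else D.stateA with ht
      by_cases hp : D.IsOverPt p ↔ b = true
      · have hp' : ¬ (D.IsOverPt (D.smooth t p) ↔ b = true) := by rw [isOverPt_smooth]; tauto
        have hq : D.IsOverPt (D.along (D.smooth t p)) ↔ b = true := by
          rw [hD.isOverPt_along]; tauto
        have := hs b _ hq
        rw [D.along_along, ← ht, D.smooth_smooth] at this
        simp only [F, if_pos hp, if_neg hp', this]
      · have hp' : D.IsOverPt (D.smooth t p) ↔ b = true := by rw [isOverPt_smooth]; tauto
        have hq : D.IsOverPt (D.along p) ↔ b = true := by rw [hD.isOverPt_along]; tauto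
        have := hs b _ hq
        rw [D.along_along, ← ht] at this
        simp only [F, if_neg hp, if_pos hp', this]
  have hcard := card_quot_eq_of_map (r := r) g ?_ ?_ ?_
  · rw [hcard, Nat.card_sum]
    rfl
  · rintro (c | c) <;> obtain ⟨p, rfl⟩ := Quot.exists_rep c
    · by_cases hp : D.IsOverPt p
      · exact ⟨D.along p, by rw [hgu _ (by rw [hD.isOverPt_along]; tauto), ← hAa]⟩
      · exact ⟨p, hgu p hp⟩
    · by_cases hp : D.IsOverPt p
      · exact ⟨p, hgo p hp⟩
      · exact ⟨D.along p, by rw [hgo _ (by rw [hD.isOverPt_along]; exact hp), ← hBa]⟩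
  · rintro p q rfl
    by_cases hp : D.IsOverPt p
    · rw [hgo p hp, hgo _ ((hD.isOverPt_nextOnFace p).2 hp), (hD.nextOnFace_eq p).1 hp, ← hBs,
        ← hBa]
    · rw [hgu p hp, hgu _ (by rwa [hD.isOverPt_nextOnFace p]), (hD.nextOnFace_eq p).2 hp, ← hAs,
        ← hAa]
  · intro p q hpq
    by_cases hp : D.IsOverPt p <;> by_cases hq : D.IsOverPt q
    · rw [hgo p hp, hgo q hq] at hpq
      have := congrArg (Quot.lift (F true) (hF true)) (Sum.inr_injective hpq)
      simpa [F, hp, hq] using this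
    · rw [hgo p hp, hgu q hq] at hpq
      cases hpq
    · rw [hgu p hp, hgo q hq] at hpq
      cases hpq
    · rw [hgu p hp, hgu q hq] at hpq
      have := congrArg (Quot.lift (F false) (hF false)) (Sum.inl_injective hpq)
      simpa [F, hp, hq] using this

theorem card_quot_edge (D : LinkDiagram n) :
    Nat.card (Quot fun h h' : Fin n × ZMod 4 => h' = D.edge h) = 2 * n := by
  have h := card_quot_involution D.edge D.edge_edge D.edge_ne
  rw [Nat.card_prod, Nat.card_fin, Nat.card_zmod] at h
  omega

/-- With 2n edges, `planar` reads F = n + 2C. A circle without crossings adds two to both sides.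
With every crossing kept, `s` does not affect the components. -/
theorem IsAlternating.numCircles_add_numCircles_eq {D : LinkDiagram n} (hD : D.IsAlternating)
    (s : Fin n → Bool) :
    D.numCircles D.stateA + D.numCircles D.stateB = n + 2 * D.numComponents ∅ s := by
  have h := D.planar
  rw [hD.numCircles_add_numCircles, card_quot_nextOnFace, numComponents_empty]
  rw [card_quot_edge] at h
  push_cast at h
  omega

/-! ### Topology of the Turaev surface -/

/-- The points of the Turaev surface at one crossing are connected by the boundary of its saddle. -/
theorem mk_eq_mk_of_saddle (D : LinkDiagram n) {r : D.Pt × Bool → D.Pt × Bool → Prop}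
    (h₀ : ∀ v, r v (D.turaevSurface.inv 0 v)) (h₁ : ∀ v, r v (D.turaevSurface.inv 1 v))
    (x : Fin n) (i j : ZMod 4) (b b' : Bool) :
    Quot.mk r (.inl (x, i), b) = Quot.mk r (.inl (x, j), b') := by
  have hv : ∀ p b, Quot.mk r (p, b) = Quot.mk r (p, true) := by
    rintro p (_ | _)
    · exact Quot.sound (h₀ (p, false))
    · rfl
  have hA : ∀ p, Quot.mk r (p, true) = Quot.mk r (D.smooth D.stateA p, true) := fun p =>
    Quot.sound (h₁ (p, true))
  have hB : ∀ p, Quot.mk r (p, true) = Quot.mk r (D.smooth D.stateB p, true) := fun p => by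
    rw [← hv p false, ← hv _ false]
    exact Quot.sound (h₁ (p, false))
  -- The two levels carry opposite smoothings at `x`, so both reflections preserve the class;
  -- together they act transitively on the four ends.
  have h₁₃ : ∀ i : ZMod 4,
      Quot.mk r (.inl (x, i), true) = Quot.mk r (.inl (x, 1 - i), true) ∧
      Quot.mk r (.inl (x, i), true) = Quot.mk r (.inl (x, 3 - i), true) := by
    intro i
    have a := hA (.inl (x, i))
    have b := hB (.inl (x, i))
    cases ho : D.overEven x
    · simp only [smooth, stateA, stateB, ho] at a b
      exact ⟨a, b⟩
    · simp only [smooth, stateA, stateB, ho] at a b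
      exact ⟨b, a⟩
  have h0 : ∀ i : ZMod 4,
      Quot.mk r (.inl (x, i), true) = Quot.mk r (.inl (x, 0), true) := by
    have key : ∀ i : ZMod 4, i = 0 ∨ 1 - i = 0 ∨ 3 - i = 0 ∨ 3 - (1 - i) = 0 := by decide
    intro i
    rcases key i with h | h | h | h
    · rw [h]
    · rw [(h₁₃ i).1, h]
    · rw [(h₁₃ i).2, h]
    · rw [(h₁₃ i).1, (h₁₃ (1 - i)).2, h]
  rw [hv, h0, hv _ b', h0 j]

theorem card_pt (D : LinkDiagram n) : Nat.card D.Pt = 4 * n + 2 * D.circles := by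
  simp [Pt, mul_comm]

/-- The 3-valent graph contributes −(4n + 2 `circles`); the bands and saddles number (2n +
`circles`) + (n + `circles`), which leaves −n plus the state discs. -/
theorem eulerChar_turaevSurface (D : LinkDiagram n) :
    D.turaevSurface.eulerChar = D.numCircles D.stateA + D.numCircles D.stateB - (n : ℤ) := by
  have hV : Nat.card (D.Pt × Bool) = 2 * (4 * n + 2 * D.circles) := by
    rw [Nat.card_prod, card_pt]
    simp [mul_comm]
  have hE : ∀ c, Nat.card (Quot fun v w => w = D.turaevSurface.inv c v) =
      4 * n + 2 * D.circles := by
    intro c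
    have := card_quot_involution _ (D.turaevSurface.inv_inv c) (D.turaevSurface.inv_ne c)
    omega
  have h0 : Nat.card (Quot fun v w => ∃ d, d ≠ 0 ∧ w = D.turaevSurface.inv d v) =
      D.numCircles D.stateA + D.numCircles D.stateB := by
    let g : D.Pt × Bool → Quot (D.JoinedInState D.stateA) ⊕ Quot (D.JoinedInState D.stateB) :=
      fun v => if v.2 then .inl (Quot.mk _ v.1) else .inr (Quot.mk _ v.1)
    rw [card_quot_eq_of_map g, Nat.card_sum]
    · rfl
    · rintro (c | c) <;> obtain ⟨p, rfl⟩ := Quot.exists_rep c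
      · exact ⟨(p, true), rfl⟩
      · exact ⟨(p, false), rfl⟩
    · rintro ⟨p, b⟩ w ⟨d, hd, rfl⟩
      fin_cases d
      · exact absurd rfl hd
      · cases b
        · exact congrArg Sum.inr (Quot.sound (.inr rfl))
        · exact congrArg Sum.inl (Quot.sound (.inr rfl))
      · cases b
        · exact congrArg Sum.inr (Quot.sound (.inl rfl))
        · exact congrArg Sum.inl (Quot.sound (.inl rfl))
    · rintro ⟨p, b⟩ ⟨q, b'⟩ h
      cases b <;> cases b'
      · refine congrArg (Quot.map (fun p => (p, false)) ?_) (Sum.inr_injective h)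
        rintro p q (rfl | rfl)
        · exact ⟨2, by decide, rfl⟩
        · exact ⟨1, by decide, rfl⟩
      · cases h
      · cases h
      · refine congrArg (Quot.map (fun p => (p, true)) ?_) (Sum.inl_injective h)
        rintro p q (rfl | rfl)
        · exact ⟨2, by decide, rfl⟩
        · exact ⟨1, by decide, rfl⟩
  have h1 : Nat.card (Quot fun v w => ∃ d, d ≠ 1 ∧ w = D.turaevSurface.inv d v) =
      2 * n + D.circles := by
    have hal := card_quot_involution D.along D.along_along D.along_ne
    rw [card_pt] at hal
    let g : D.Pt × Bool → Quot fun p q => q = D.along p := fun v => Quot.mk _ v.1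
    rw [card_quot_eq_of_map g]
    · omega
    · rintro ⟨p⟩
      exact ⟨(p, true), rfl⟩
    · rintro ⟨p, b⟩ w ⟨d, hd, rfl⟩
      fin_cases d
      · rfl
      · exact absurd rfl hd
      · exact Quot.sound rfl
    · rintro ⟨p, b⟩ ⟨q, b'⟩ h
      have h' := congrArg (Quot.map (fun p => (p, b))
        (rb := fun v w => ∃ d, d ≠ 1 ∧ w = D.turaevSurface.inv d v) (by
          rintro p q rfl
          exact ⟨2, by decide, rfl⟩)) h
      refine Eq.trans h' ?_
      by_cases hb : b' = b
      · rw [hb]; rfl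
      · refine Quot.sound ⟨0, by decide, ?_⟩
        cases b <;> cases b' <;> simp_all [turaevSurface]
  have h2 : Nat.card (Quot fun v w => ∃ d, d ≠ 2 ∧ w = D.turaevSurface.inv d v) =
      n + D.circles := by
    let g : D.Pt × Bool → Fin n ⊕ Fin D.circles := fun v => Sum.map Prod.fst Prod.fst v.1
    rw [card_quot_eq_of_map g, Nat.card_sum, Nat.card_fin, Nat.card_fin]
    · rintro (x | i)
      · exact ⟨(.inl (x, 0), true), rfl⟩
      · exact ⟨(.inr (i, true), true), rfl⟩
    · rintro ⟨p, b⟩ w ⟨d, hd, rfl⟩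
      fin_cases d
      · rfl
      · rcases p with p | p <;> rfl
      · exact absurd rfl hd
    · have h₀ : ∀ v, ∃ d, d ≠ 2 ∧ D.turaevSurface.inv 0 v = D.turaevSurface.inv d v :=
        fun v => ⟨0, by decide, rfl⟩
      have h₁ : ∀ v, ∃ d, d ≠ 2 ∧ D.turaevSurface.inv 1 v = D.turaevSurface.inv d v :=
        fun v => ⟨1, by decide, rfl⟩
      rintro ⟨⟨x, i⟩ | ⟨i, e⟩, b⟩ ⟨⟨y, j⟩ | ⟨j, e'⟩, b'⟩ h
      · obtain rfl : x = y := Sum.inl_injective h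
        exact D.mk_eq_mk_of_saddle h₀ h₁ x i j b b'
      · cases h
      · cases h
      · obtain rfl : i = j := Sum.inr_injective h
        have hv : ∀ e b, Quot.mk (fun v w => ∃ d, d ≠ 2 ∧ w = D.turaevSurface.inv d v)
            (.inr (i, e), b) = Quot.mk _ (.inr (i, true), true) := by
          have hs : ∀ e, Quot.mk (fun v w => ∃ d, d ≠ 2 ∧ w = D.turaevSurface.inv d v)
              (.inr (i, e), true) = Quot.mk _ (.inr (i, true), true) := by
            rintro (_ | _)
            · exact Quot.sound (h₁ (.inr (i, false), true))
            · rfl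
          rintro e (_ | _)
          · exact (Quot.sound (h₀ (.inr (i, e), false))).trans (hs e)
          · exact hs e
        rw [hv, hv e' b']
  rw [CellSurface.eulerChar, Fin.sum_univ_three, Fin.sum_univ_three, hV, hE, hE, hE, h0, h1, h2]
  push_cast
  ring

theorem isConnected_turaevSurface (D : LinkDiagram n) {K : Finset (Fin n)} {s : Fin n → Bool}
    (h : D.numComponents K s = 1) : D.turaevSurface.IsConnected := by
  obtain ⟨hsub, ⟨c⟩⟩ := Nat.card_eq_one_iff_unique.1 h
  obtain ⟨p₀, -⟩ := Quot.exists_rep c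
  let r : D.Pt × Bool → D.Pt × Bool → Prop := fun v w => ∃ d, w = D.turaevSurface.inv d v
  have hx : ∀ x i j, Quot.mk r (.inl (x, i), true) = Quot.mk r (.inl (x, j), true) :=
    fun x i j => D.mk_eq_mk_of_saddle (fun v => ⟨0, rfl⟩) (fun v => ⟨1, rfl⟩) x i j true true
  have hr : ∀ p q, D.JoinedAfter K s p q → Quot.mk r (p, true) = Quot.mk r (q, true) := by
    rintro p q (rfl | rfl | ⟨x, -, i, j, rfl, rfl⟩)
    · exact Quot.sound ⟨2, rfl⟩
    · rcases p with ⟨x, i⟩ | ⟨i, e⟩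
      · exact hx x i _
      · exact Quot.sound ⟨1, rfl⟩
    · exact hx x i j
  refine Nat.card_eq_one_iff_unique.2 ⟨⟨?_⟩, ⟨Quot.mk r (p₀, true)⟩⟩
  have hall : ∀ v, Quot.mk r v = Quot.mk r (p₀, true) := by
    have ht : ∀ p, Quot.mk r (p, true) = Quot.mk r (p₀, true) := fun p =>
      congrArg (Quot.lift (fun p => Quot.mk r (p, true)) hr)
        (hsub.elim (Quot.mk _ p) (Quot.mk _ p₀))
    rintro ⟨p, _ | _⟩
    · exact (Quot.sound ⟨0, rfl⟩).trans (ht p)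
    · exact ht p
  rintro ⟨v⟩ ⟨w⟩
  exact (hall v).trans (hall w).symm

/-- Switching leaves the projection unchanged. The alternating over/under pattern flips along
colours `1` and `2`, the level flips along colour `0`, so their exclusive or flips along every edge.
-/
theorem isOrientable_turaevSurface (D : LinkDiagram n) {K : Finset (Fin n)}
    (h : (D.switch K).IsAlternating) : D.turaevSurface.IsOrientable := by
  classical
  let ov : D.Pt → Prop := (D.switch K).IsOverPt
  refine ⟨fun v => decide (ov v.1) ^^ v.2, ?_⟩
  rintro c ⟨p, b⟩
  have hneg : ∀ q, (ov q ↔ ¬ ov p) → (decide (ov q) ^^ b) = !(decide (ov p) ^^ b) := by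
    intro q hq
    by_cases hp : ov p <;> simp [hq, hp]
  fin_cases c
  · exact Bool.xor_not (decide (ov p)) b
  · refine hneg (D.smooth (if b then D.stateA else D.stateB) p) ?_
    rw [← D.smooth_switch K]
    exact (D.switch K).isOverPt_smooth _ p
  · refine hneg (D.along p) ?_
    rw [← D.along_switch K]
    exact h.isOverPt_along p

end LinkDiagram

/-! ### The genus -/

theorem mainTheorem2 {n : ℕ} (D : LinkDiagram n) (k : ℕ) (hD : D.IsAlmostAlternating k)
    (K : Finset (Fin n)) (hK : D.IsDealternatorSet K) (hconn : D.IsDealternatorConnected K) :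
    D.turaevSurface.HasGenus k := by
  obtain ⟨halt, hmin⟩ := hK
  obtain rfl : K.card = k := hmin.unique hD
  set E := D.switch K with hE
  refine ⟨D.isConnected_turaevSurface (hconn D.stateA), D.isOrientable_turaevSurface halt, ?_⟩
  have hAB : E.numCircles E.stateA + E.numCircles E.stateB = n + 2 * E.numComponents ∅ E.stateA :=
    halt.numCircles_add_numCircles_eq E.stateA
  have hBA : E.numCircles E.stateA + E.numCircles E.stateB = n + 2 * E.numComponents ∅ E.stateB :=
    halt.numCircles_add_numCircles_eq E.stateB
  have hnA : (fun x => !E.stateA x) = E.stateB := rfl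
  have hnB : (fun x => !E.stateB x) = E.stateA := by
    ext x; simp [LinkDiagram.stateA, LinkDiagram.stateB]
  -- `D` and `E` have opposite overstrands on `K` and equal ones elsewhere, so `s_B D` agrees with
  -- `s_A E` exactly on `K`.
  have hfA : LinkDiagram.flipOutside E.stateA K = D.stateB := by
    ext x
    by_cases hx : x ∈ K <;>
      simp [LinkDiagram.flipOutside, LinkDiagram.stateA, LinkDiagram.stateB, hE,
        LinkDiagram.switch, hx]
  have hfB : LinkDiagram.flipOutside E.stateB K = D.stateA := by
    ext x
    by_cases hx : x ∈ K <;>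
      simp [LinkDiagram.flipOutside, LinkDiagram.stateA, LinkDiagram.stateB, hE,
        LinkDiagram.switch, hx]
  have h₁ := E.numCircles_add_numCircles_of_planar E.stateA K (by rw [hnA]; exact hAB)
  have h₂ := E.numCircles_add_numCircles_of_planar E.stateB K
    (by rw [hnB, add_comm]; exact hBA)
  have hcA : E.numComponents K E.stateA = 1 := (D.numComponents_switch K K _).trans (hconn _)
  have hcB : E.numComponents K E.stateB = 1 := (D.numComponents_switch K K _).trans (hconn _)
  have hc : E.numComponents ∅ E.stateA = 1 := E.numComponents_empty_eq_one hcA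
  rw [hfA, hcA] at h₁
  rw [hfB, hcB] at h₂
  rw [D.eulerChar_turaevSurface]
  simp only [hE, LinkDiagram.numCircles_switch] at *
  omega
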